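/- A transmitter (Tx) is located at the origin of the plane $\mathbb{R}^2$ (the ground), a legitimate receiver (Rx) at a point $q_r\neq 0$ of the plane with $\ell_r=|q_r|$, and a jammer at height $z_u\ge 0$ above a ground point $u$ at horizontal distance $d_{tu}=|u|$ from the Tx. Eavesdroppers are located at the points of a homogeneous Poisson point process of density $\lambda_e>0$ on the plane. For a ground node at a point $x$ (the Rx or an eavesdropper), let $\rho_x=P_t|x|^{-\alpha_N}$, $d_x=|x-u|$, $j_x=\sqrt{d_x^2+z_u^2}$ and $\tau_x^{(e)}=P_u\,j_x^{-\alpha_e}$ for $e\in\{L,N\}$. The signal-to-interference-plus-noise ratio at the node is $$\gamma_x=\frac{h_{t}\,\rho_x}{h_{u}\,\tau_x^{(e)}+\sigma^2},$$ where $h_t$ is exponential with mean $1$ and, independently, the jammer's link is in line of sight ($e=L$) with probability $p_L(d_x,z_u)$, in which case $h_u$ is gamma distributed with shape and rate $m_L$ (Nakagami-$m_L$ fading with mean $1$), and is not in line of sight ($e=N$) with probability $p_N=1-p_L$, in which case $h_u$ is exponential with mean $1$. Here $$p_L(d,z)=\Big\{1-\frac{\sqrt{2\pi}\,\zeta}{z}\Big|Q\Big(\frac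 z\zeta\Big)-\frac12\Big|\Big\}^{d\sqrt{\nu\mu}},\qquad Q(x)=\int_x^\infty \frac{e^{-t^2/2}}{\sqrt{2\pi}}\,dt,$$ the base of the power being read as its limit $0$ when $z=0$. The parameters $P_t,P_u,\sigma^2,\alpha_L,\alpha_N,m_L,\zeta,\nu,\mu$ and the targets $\gamma_t,\gamma_t'$ are positive. Given their locations, the channels (fading gains and environments) of the eavesdroppers are independent, and the channel of the Rx is independent of the locations and channels of all eavesdroppers. The secrecy transmission probability is $$p_{se}=\mathbb{P}\big[\gamma_r>\gamma_t,\ \max_{i}\gamma_{e_i}<\gamma_t'\big],$$ where $\gamma_r$ and $\gamma_{e_i}$ are the ratios at the Rx and at the eavesdroppers. Put, with $d_r,\rho_r,\tau_r^{(e)}$ taken at $x=q_r$, $$p_s=\frac{m_L^{m_L}}{\big(\gamma_t\tau_r^{(L)}/\rho_r+m_L\big)^{m_L}}e^{-\gamma_t\sigma^2/\rho_r}\,p_L(d_r,z_u)+\frac{\rho_r}{\rho_r+\gamma_t\tau_r^{(N)}}e^{-\gamma_t\sigma^2/\rho_r}\,p_N(d_r,z_u).$$ Then, as the jammer approaches the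 transmitter, that is, as $d_{tu}\to0$ and $z_u\to0$ jointly (with $z_u\ge0$), $$p_{se}\ \approx\ p_s\cdot\exp\left\{\frac{-2\pi\lambda_e P_t\,\Gamma(2/\alpha_N)}{(\gamma_t'P_u+P_t)\,\alpha_N\,(\gamma_t'\sigma^2/P_t)^{2/\alpha_N}}\right\},$$ in the sense that the ratio of the two sides tends to $1$ and their difference tends to $0$. -/

import Mathlib

open MeasureTheory ProbabilityTheory Filter Topology

namespace UAVJammer

noncomputable section

/-- The ground plane `ℝ²`, with its Euclidean norm and Lebesgue measure.
The transmitter (Tx) sits at the origin. -/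
abbrev Ground : Type := EuclideanSpace ℝ (Fin 2)

/-- The parameters of the network, all of them fixed once and for all. -/
structure Params where
  /-- transmission power of the Tx -/
  Pt : ℝ
  /-- transmission power of the Jammer -/
  Pu : ℝ
  /-- noise power `σ²` -/
  noise : ℝ
  /-- target SINR of the legitimate channel -/
  γt : ℝ
  /-- target SINR of the wiretap channel -/
  γt' : ℝ
  /-- density of the eavesdroppers (Eves) -/
  lamE : ℝ
  /-- line-of-sight (LoS) path loss exponent -/
  αL : ℝ
  /-- non-line-of-sight (NLoS) path loss exponent -/
  αN : ℝ
  /-- Nakagami fading parameter of a LoS link -/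
  mL : ℝ
  /-- environment parameter -/
  ζ : ℝ
  /-- environment parameter -/
  ν : ℝ
  /-- environment parameter -/
  μ : ℝ
  /-- location of the legitimate receiver (Rx) on the ground -/
  rx : Ground
  Pt_pos : 0 < Pt
  Pu_pos : 0 < Pu
  noise_pos : 0 < noise
  γt_pos : 0 < γt
  γt'_pos : 0 < γt'
  lamE_pos : 0 < lamE
  αL_pos : 0 < αL
  αN_pos : 0 < αN
  mL_pos : 0 < mL
  ζ_pos : 0 < ζ
  ν_pos : 0 < ν
  μ_pos : 0 < μ
  rx_ne : rx ≠ 0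

/-- The Gaussian tail function `Q`. -/
def qFun (x : ℝ) : ℝ :=
  ∫ t in Set.Ioi x, 1 / Real.sqrt (2 * Real.pi) * Real.exp (-(t ^ 2 / 2))

/-- The base of the LoS probability. At height `z = 0`, where the expression reads `0 / 0`,
it is extended by its limit, which is `0`. -/
def losBase (S : Params) (z : ℝ) : ℝ :=
  if z = 0 then 0
  else 1 - Real.sqrt (2 * Real.pi) * S.ζ / z * |qFun (z / S.ζ) - 1 / 2|

/-- The LoS probability `p_L(d, z)` at horizontal distance `d` and height `z`. -/
def pLos (S : Params) (d z : ℝ) : ℝ :=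
  losBase S z ^ (d * Real.sqrt (S.ν * S.μ))

/-- The NLoS probability `p_N(d, z)`. -/
def pNlos (S : Params) (d z : ℝ) : ℝ := 1 - pLos S d z

/-- The two possible environments of an air-to-ground link are encoded by `Bool`:
`true` is LoS, `false` is NLoS. This is the path loss exponent in each of them. -/
def pathLossExp (S : Params) (los : Bool) : ℝ := if los then S.αL else S.αN

/-- `ρ`: mean power received from the Tx at the ground point `x`
(a ground-to-ground link, hence NLoS). -/
def rho (S : Params) (x : Ground) : ℝ := ‖x‖ ^ (-S.αN) * S.Pt

/-- Distance between the Jammer, at height `z` above the ground point `u`, and the ground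
point `x`. -/
def jamDist (u : Ground) (z : ℝ) (x : Ground) : ℝ := Real.sqrt (dist u x ^ 2 + z ^ 2)

/-- `τ`: mean power received from the Jammer at the ground point `x`, depending on the
environment of the air-to-ground link. -/
def tau (S : Params) (u : Ground) (z : ℝ) (x : Ground) (los : Bool) : ℝ :=
  jamDist u z x ^ (-pathLossExp S los) * S.Pu

/-- The random channel of a ground node: the fading gain of its link from the Tx, the
environment (`true`: LoS, `false`: NLoS) of its link from the Jammer, and the fading gain of
its link from the Jammer. -/
abbrev Channel : Type := ℝ × Bool × ℝ

/-- The SINR at a node at the ground point `x` with channel `c`. -/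
def sinr (S : Params) (u : Ground) (z : ℝ) (x : Ground) (c : Channel) : ℝ :=
  c.1 * rho S x / (c.2.2 * tau S u z x c.2.1 + S.noise)

/-- The law of the channel of a node at the ground point `x`. The link from the Tx has Rayleigh
fading (a unit-mean exponential gain). Independently of it, the link from the Jammer is LoS with
probability `p_L` and then has Nakagami fading with unit mean (a gamma gain with shape and rate
`mL`), or NLoS with probability `p_N` and then has Rayleigh fading. -/
def channelLaw (S : Params) (u : Ground) (z : ℝ) (x : Ground) : Measure Channel :=
  (expMeasure 1).prod
    (ENNReal.ofReal (pLos S (dist u x) z) •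
        (Measure.dirac true).prod (gammaMeasure S.mL S.mL) +
      ENNReal.ofReal (pNlos S (dist u x) z) •
        (Measure.dirac false).prod (expMeasure 1))

/-- The number of points of the configuration `(X i)` that lie in `B`. -/
def pointCount {Ω E : Type*} (X : ℕ → Ω → E) (B : Set E) (ω : Ω) : ℕ∞ :=
  {i : ℕ | X i ω ∈ B}.encard

/-- The random points `X 0, X 1, …` are an enumeration of a Poisson point process with intensity
measure `Λ` (of infinite total mass, so that there are infinitely many points): the number of
points in a set of finite intensity is Poisson distributed, and the numbers of points in disjoint
sets are independent. -/
structure IsPoissonPointProcess {Ω E : Type*} [MeasurableSpace Ω] [MeasurableSpace E]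
    (X : ℕ → Ω → E) (Λ : Measure E) (P : Measure Ω) : Prop where
  measurable : ∀ i, Measurable (X i)
  law : ∀ B : Set E, MeasurableSet B → Λ B ≠ ⊤ →
    P.map (pointCount X B) = (poissonMeasure (Λ B).toNNReal).map (fun n : ℕ => (n : ℕ∞))
  indep : ∀ (n : ℕ) (B : Fin n → Set E), (∀ j, MeasurableSet (B j)) →
    Pairwise (fun j k => Disjoint (B j) (B k)) →
    iIndepFun (fun j => pointCount X (B j)) P

/-- A realization, on the probability space `(Ω, P)`, of the network with the Jammer at height `z`
above the ground point `u`: the channel of the Rx, and the locations and channels of the Eves. -/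
structure Network (S : Params) (u : Ground) (z : ℝ) {Ω : Type*} [MeasurableSpace Ω]
    (P : Measure Ω) where
  /-- channel of the Rx -/
  rxChannel : Ω → Channel
  /-- locations of the Eves -/
  eve : ℕ → Ω → Ground
  /-- channels of the Eves -/
  eveChannel : ℕ → Ω → Channel
  measurable_rxChannel : Measurable rxChannel
  measurable_eveChannel : ∀ i, Measurable (eveChannel i)
  rxChannel_law : P.map rxChannel = channelLaw S u z S.rx
  /-- The Eves form a homogeneous Poisson point process with density `lamE`. -/
  eve_poisson : IsPoissonPointProcess eve (ENNReal.ofReal S.lamE • (volume : Measure Ground)) P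
  /-- Given the locations of all Eves, their channels are independent, and the channel of an Eve
  at `x` has the law `channelLaw S u z x`. -/
  eveChannel_law : ∀ (s : Finset ℕ) (A : ℕ → Set (Ground × Channel)),
    (∀ i, MeasurableSet (A i)) →
    P {ω | ∀ i ∈ s, (eve i ω, eveChannel i ω) ∈ A i} =
      ∫⁻ ω, ∏ i ∈ s, channelLaw S u z (eve i ω) {c | (eve i ω, c) ∈ A i} ∂P
  /-- The legitimate channel and the wiretap channels are independent. -/
  indep : IndepFun rxChannel (fun ω (i : ℕ) => (eve i ω, eveChannel i ω)) P

/-- The secrecy transmission probability: the probability that the SINR of the Rx exceeds its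
target, while the SINRs of all Eves stay below theirs. -/
def Network.secrecyProb {S : Params} {u : Ground} {z : ℝ} {Ω : Type*} [MeasurableSpace Ω]
    {P : Measure Ω} (N : Network S u z P) : ℝ :=
  P.real {ω | S.γt < sinr S u z S.rx (N.rxChannel ω) ∧
    ∀ i, sinr S u z (N.eve i ω) (N.eveChannel i ω) < S.γt'}

/-- The closed form of the successful transmission probability `p_s`. -/
def successProb (S : Params) (u : Ground) (z : ℝ) : ℝ :=
  S.mL ^ S.mL / (S.γt * tau S u z S.rx true / rho S S.rx + S.mL) ^ S.mL
      * Real.exp (-(S.γt * S.noise / rho S S.rx)) * pLos S (dist u S.rx) z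
    + rho S S.rx / (rho S S.rx + S.γt * tau S u z S.rx false)
      * Real.exp (-(S.γt * S.noise / rho S S.rx)) * pNlos S (dist u S.rx) z

/-- The limiting probability that no Eve eavesdrops. -/
def secrecyFactor (S : Params) : ℝ :=
  Real.exp (-(2 * Real.pi * S.lamE * S.Pt * Real.Gamma (2 / S.αN)) /
    ((S.γt' * S.Pu + S.Pt) * S.αN * (S.γt' * S.noise / S.Pt) ^ (2 / S.αN)))

end

end UAVJammer

/-! For every fixed Jammer position, the secrecy probability has an exact product form
(`Network.secrecyProb_eq`). Independence of the Rx channel splits off `p_s`, and the other factor is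
the void probability of the eavesdroppers that succeed. Conditionally on the locations, that event
has probability `∏ (1 - g (X i))`, with `g` the success probability at a point. The probability
generating functional of the Poisson process (`IsPoissonPointProcess.lintegral_iInf_prod`) turns its
mean into `exp (-λ ∫ g)`.

Only `∫ g` then needs a limit. As the Jammer approaches the Tx, the LoS probability vanishes at
every `x ≠ 0`. In the NLoS case both path losses become `‖x‖ ^ (-αN)`, so their ratio no longer
depends on `x` and `g x` tends to `Pt / (γt' Pu + Pt) * exp (-c ‖x‖ ^ αN)`, where `c = γt' σ² / Pt`.
Noise alone gives the dominating function `exp (-c ‖x‖ ^ αN)`, whatever the Jammer does, and polar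
coordinates evaluate the limiting integral as a Gamma value. -/

open scoped ENNReal NNReal

namespace UAVJammer

/-! ### Generating functional of a Poisson point process. -/

/-- Probability generating function of the Poisson distribution. -/
lemma lintegral_pow_poissonMeasure (r : ℝ≥0) {a : ℝ≥0∞} (ha : a ≤ 1) :
    ∫⁻ n : ℕ, (1 - a) ^ n ∂(poissonMeasure r)
      = ENNReal.ofReal (Real.exp (-(a * r : ℝ≥0∞).toReal)) := by
  obtain ⟨b, hb⟩ : ∃ b : ℝ, b = (1 - a).toReal := ⟨_, rfl⟩
  have hb0 : 0 ≤ b := hb ▸ ENNReal.toReal_nonneg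
  have h1a : 1 - a = ENNReal.ofReal b := by
    rw [hb, ENNReal.ofReal_toReal (ne_top_of_le_ne_top ENNReal.one_ne_top tsub_le_self)]
  have hba : b = 1 - a.toReal := by
    rw [hb, ENNReal.toReal_sub_of_le ha ENNReal.one_ne_top, ENNReal.toReal_one]
  rw [poissonMeasure, lintegral_sum_measure]
  simp only [lintegral_smul_measure, lintegral_dirac, smul_eq_mul, h1a]
  have hs : HasSum (fun n : ℕ ↦ Real.exp (-r) * (r : ℝ) ^ n / (n.factorial) * b ^ n)
      (Real.exp (-(a * r : ℝ≥0∞).toReal)) := by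
    convert! (NormedSpace.expSeries_div_hasSum_exp ((r : ℝ) * b)).mul_left (Real.exp (-r)) using 1
    · ext n; rw [mul_pow]; ring
    · rw [← Real.exp_eq_exp_ℝ, ← Real.exp_add, ENNReal.toReal_mul, ENNReal.coe_toReal, hba]
      ring_nf
  rw [← hs.tsum_eq, ENNReal.ofReal_tsum_of_nonneg (fun n ↦ by positivity) hs.summable]
  congr with n
  rw [ENNReal.ofReal_mul (by positivity), ENNReal.ofReal_pow hb0]

/-- A product with finitely many nontrivial factors, grouped by the values of the factors. -/
lemma iInf_prod_range_one_sub_eq (y : ℕ → ℝ≥0∞) (t : Finset ℝ≥0∞) (h0 : 0 ∉ t)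
    (hy : ∀ i, y i ≠ 0 → y i ∈ t) (hfin : ∀ a ∈ t, {i | y i = a}.Finite) :
    ⨅ n, ∏ i ∈ Finset.range n, (1 - y i) = ∏ a ∈ t, (1 - a) ^ {i | y i = a}.encard.toNat := by
  classical
  have hF : {i | y i ≠ 0}.Finite := by
    refine (t.finite_toSet.biUnion (t := fun a ↦ {i | y i = a}) hfin).subset fun i hi ↦ ?_
    simpa using hy i hi
  have hprod : ∀ n, hF.toFinset ⊆ Finset.range n →
      ∏ i ∈ Finset.range n, (1 - y i) = ∏ i ∈ hF.toFinset, (1 - y i) := by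
    intro n hn
    refine (Finset.prod_subset hn fun i _ hi ↦ ?_).symm
    have : y i = 0 := by simpa using hi
    simp [this]
  obtain ⟨M, hM⟩ : ∃ M, hF.toFinset ⊆ Finset.range M := hF.toFinset.exists_nat_subset_range
  have hanti : Antitone fun n ↦ ∏ i ∈ Finset.range n, (1 - y i) :=
    antitone_nat_of_succ_le fun n ↦ by
      rw [Finset.prod_range_succ]; exact mul_le_of_le_one_right' tsub_le_self
  -- The partial products decrease and are constant once the range covers the support of `y`.
  have hinf : ⨅ n, ∏ i ∈ Finset.range n, (1 - y i) = ∏ i ∈ hF.toFinset, (1 - y i) := by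
    refine le_antisymm ((iInf_le _ M).trans_eq (hprod M hM)) (le_iInf fun n ↦ ?_)
    rw [← hprod (max n M) (hM.trans (Finset.range_mono (le_max_right _ _)))]
    exact hanti (le_max_left _ _)
  rw [hinf, ← Finset.prod_fiberwise_of_maps_to (t := t) (g := y) (fun i
    hi ↦ hy i (by simpa using hi))]
  refine Finset.prod_congr rfl fun a ha ↦ ?_
  have hset : {i | y i = a} = ((hF.toFinset.filter fun i ↦ y i = a : Finset ℕ) : Set ℕ) := by
    ext i
    simp only [Set.mem_ofPred_eq, Finset.coe_filter, Set.Finite.mem_toFinset]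
    refine ⟨fun h ↦ ⟨?_, h⟩, fun h ↦ h.2⟩
    rintro h'
    exact h0 (h' ▸ h ▸ ha)
  rw [hset, Set.encard_coe_eq_coe_finsetCard, ENat.toNat_natCast]
  exact Finset.prod_eq_pow_card fun i hi ↦ by rw [(Finset.mem_filter.1 hi).2]

section PoissonPointProcess

variable {Ω E : Type*} [MeasurableSpace Ω] [MeasurableSpace E] {X : ℕ → Ω → E} {Λ : Measure E}
  {P : Measure Ω}

/-- Forced by the law axiom: `Measure.map` along a function that is not a.e. measurable is zero,
whereas the Poisson law has mass one. -/
lemma IsPoissonPointProcess.aemeasurable_pointCount (hX : IsPoissonPointProcess X Λ P)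
    {B : Set E} (hB : MeasurableSet B) (hΛ : Λ B ≠ ⊤) : AEMeasurable (pointCount X B) P := by
  by_contra h
  have h1 := hX.law B hB hΛ
  rw [Measure.map_of_not_aemeasurable h] at h1
  have : IsProbabilityMeasure ((poissonMeasure (Λ B).toNNReal).map (fun n : ℕ => (n : ℕ∞))) :=
    Measure.isProbabilityMeasure_map .of_discrete
  exact this.ne_zero _ h1.symm

lemma IsPoissonPointProcess.ae_pointCount_ne_top (hX : IsPoissonPointProcess X Λ P)
    {B : Set E} (hB : MeasurableSet B) (hΛ : Λ B ≠ ⊤) : ∀ᵐ ω ∂P, pointCount X B ω ≠ ⊤ := by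
  refine ae_of_ae_map (p := fun k : ℕ∞ ↦ k ≠ ⊤) (hX.aemeasurable_pointCount hB hΛ) ?_
  rw [hX.law B hB hΛ, ae_map_iff .of_discrete .of_discrete]
  exact .of_forall fun n ↦ ENat.natCast_ne_top n

lemma IsPoissonPointProcess.lintegral_pow_pointCount (hX : IsPoissonPointProcess X Λ P)
    {B : Set E} (hB : MeasurableSet B) (hΛ : Λ B ≠ ⊤) {a : ℝ≥0∞} (ha : a ≤ 1) :
    ∫⁻ ω, (1 - a) ^ (pointCount X B ω).toNat ∂P
      = ENNReal.ofReal (Real.exp (-(a * Λ B).toReal)) := by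
  have h := lintegral_map' (μ := P) (f := fun k : ℕ∞ ↦ (1 - a) ^ k.toNat)
    Measurable.of_discrete.aemeasurable (hX.aemeasurable_pointCount hB hΛ)
  rw [← h, hX.law B hB hΛ, lintegral_map .of_discrete .of_discrete]
  simp only [ENat.toNat_natCast]
  rw [lintegral_pow_poissonMeasure _ ha, ENNReal.coe_toNNReal hΛ]

/-- The probability generating functional of a Poisson process, for a simple function. -/
lemma IsPoissonPointProcess.lintegral_iInf_prod_simpleFunc (hX : IsPoissonPointProcess X Λ P)
    (s : SimpleFunc E ℝ≥0∞) (hs1 : ∀ x, s x ≤ 1) (hs : s.lintegral Λ ≠ ⊤) :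
    ∫⁻ ω, ⨅ n, ∏ i ∈ Finset.range n, (1 - s (X i ω)) ∂P
      = ENNReal.ofReal (Real.exp (-(s.lintegral Λ).toReal)) := by
  classical
  -- Discarding the value `0` leaves level sets of finite intensity, whose counts are independent
  -- Poisson variables.
  set t := s.range.filter (· ≠ 0) with ht
  have hsum : s.lintegral Λ = ∑ a ∈ t, a * Λ (s ⁻¹' {a}) := by
    rw [ht, Finset.sum_filter_of_ne, SimpleFunc.lintegral]
    intro a _ h h0
    simp [h0] at h
  have hmul : ∀ a ∈ t, a * Λ (s ⁻¹' {a}) ≠ ⊤ := by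
    rw [hsum] at hs
    exact ENNReal.sum_ne_top.1 hs
  have hfin : ∀ a ∈ t, Λ (s ⁻¹' {a}) ≠ ⊤ := by
    intro a ha h
    apply hmul a ha
    rw [h, ENNReal.mul_top]
    exact (Finset.mem_filter.1 ha).2
  have hle : ∀ a ∈ t, a ≤ 1 := by
    intro a ha
    obtain ⟨x, rfl⟩ := SimpleFunc.mem_range.1 (Finset.mem_filter.1 ha).1
    exact hs1 x
  have hB : ∀ a, MeasurableSet (s ⁻¹' {a}) := fun a ↦ s.measurableSet_preimage _
  let e : Fin t.card ≃ t := t.equivFin.symm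
  let B : Fin t.card → Set E := fun j ↦ s ⁻¹' {(e j : ℝ≥0∞)}
  have hindep : iIndepFun (fun j ↦ pointCount X (B j)) P := by
    refine hX.indep _ B (fun j ↦ hB _) fun j k hjk ↦ ?_
    refine Set.disjoint_left.2 fun x hx hx' ↦ hjk (e.injective (Subtype.ext ?_))
    exact (Set.mem_singleton_iff.1 hx).symm.trans (Set.mem_singleton_iff.1 hx')
  let Y : Fin t.card → Ω → ℝ≥0∞ := fun j ω ↦ (1 - (e j : ℝ≥0∞)) ^ (pointCount X (B j) ω).toNat
  have hY : iIndepFun Y P :=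
    hindep.comp (fun j (k : ℕ∞) ↦ (1 - (e j : ℝ≥0∞)) ^ k.toNat) fun j ↦ .of_discrete
  have hYm : ∀ j, AEMeasurable (Y j) P := fun j ↦
    (Measurable.of_discrete (f := fun k : ℕ∞ ↦ (1 - (e j : ℝ≥0∞)) ^ k.toNat)).comp_aemeasurable
      (hX.aemeasurable_pointCount (hB _) (hfin _ (e j).2))
  -- Counts are only a.e. measurable, so measurable representatives enter the factorization of the
  -- expectation.
  have hlhs : ∫⁻ ω, ⨅ n, ∏ i ∈ Finset.range n, (1 - s (X i ω)) ∂P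
      = ∫⁻ ω, ∏ j, (hYm j).mk (Y j) ω ∂P := by
    refine lintegral_congr_ae ?_
    have h1 : ∀ᵐ ω ∂P, ∀ j, pointCount X (B j) ω ≠ ⊤ :=
      ae_all_iff.2 fun j ↦ hX.ae_pointCount_ne_top (hB _) (hfin _ (e j).2)
    have h2 : ∀ᵐ ω ∂P, ∀ j, Y j ω = (hYm j).mk (Y j) ω := ae_all_iff.2 fun j ↦ (hYm j).ae_eq_mk
    filter_upwards [h1, h2] with ω h1 h2
    simp only [← h2]
    rw [iInf_prod_range_one_sub_eq _ t (by simp [ht]) (fun i hi ↦ by simp [ht, hi])]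
    · rw [← Finset.prod_coe_sort, ← e.prod_comp]
      rfl
    · intro a ha
      have h3 := h1 (e.symm ⟨a, ha⟩)
      rw [pointCount, ne_eq, Set.encard_eq_top_iff, Set.not_infinite] at h3
      simpa [B] using h3
  rw [hlhs, lintegral_prod_eq_prod_lintegral_of_indepFun _ _
    (hY.congr fun j ↦ (hYm j).ae_eq_mk) fun j ↦ (hYm j).measurable_mk]
  have hj : ∀ j, ∫⁻ ω, (hYm j).mk (Y j) ω ∂P
      = ENNReal.ofReal (Real.exp (-((e j : ℝ≥0∞) * Λ (B j)).toReal)) := fun j ↦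
    (lintegral_congr_ae (hYm j).ae_eq_mk.symm).trans
      (hX.lintegral_pow_pointCount (hB _) (hfin _ (e j).2) (hle _ (e j).2))
  simp only [hj]
  rw [← ENNReal.ofReal_prod_of_nonneg fun _ _ ↦ (Real.exp_pos _).le, ← Real.exp_sum, hsum,
    ENNReal.toReal_sum hmul, Finset.sum_neg_distrib, ← Finset.sum_coe_sort t fun a ↦ (a * Λ (s ⁻¹' {a})).toReal,
    ← e.sum_comp]

/-- The probability generating functional of a Poisson point process. -/
theorem IsPoissonPointProcess.lintegral_iInf_prod [IsFiniteMeasure P]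
    (hX : IsPoissonPointProcess X Λ P)
    {g : E → ℝ≥0∞} (hg : Measurable g) (hg1 : ∀ x, g x ≤ 1) (hfin : ∫⁻ x, g x ∂Λ ≠ ⊤) :
    ∫⁻ ω, ⨅ n, ∏ i ∈ Finset.range n, (1 - g (X i ω)) ∂P
      = ENNReal.ofReal (Real.exp (-(∫⁻ x, g x ∂Λ).toReal)) := by
  let s : ℕ → SimpleFunc E ℝ≥0∞ := SimpleFunc.eapprox g
  have hsg : ∀ m x, s m x ≤ g x := fun m x ↦ by
    rw [← SimpleFunc.iSup_eapprox_apply hg x]; exact le_iSup (fun k ↦ s k x) m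
  have hmono : Monotone s := SimpleFunc.monotone_eapprox g
  have hlim : ∀ x, Tendsto (fun m ↦ s m x) atTop (𝓝 (g x)) := SimpleFunc.tendsto_eapprox hg
  -- Writing the infinite product as an infimum of partial products reduces the passage from `s m`
  -- to `g` to commuting two infima; for fixed `n` the finite product is continuous.
  have hswap : ∀ ω, ⨅ n, ∏ i ∈ Finset.range n, (1 - g (X i ω))
      = ⨅ m, ⨅ n, ∏ i ∈ Finset.range n, (1 - s m (X i ω)) := by
    intro ω
    rw [iInf_comm]
    congr with n
    refine tendsto_nhds_unique (f := fun m ↦ ∏ i ∈ Finset.range n, (1 - s m (X i ω))) (l := atTop)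
      ?_ (tendsto_atTop_iInf fun m m' h ↦ ?_)
    · refine ENNReal.tendsto_finsetProd_of_ne_top _ (fun i _ ↦ ?_) fun i _ ↦ ?_
      · exact ENNReal.Tendsto.sub tendsto_const_nhds (hlim _) (.inl ENNReal.one_ne_top)
      · exact ne_top_of_le_ne_top ENNReal.one_ne_top tsub_le_self
    · exact Finset.prod_le_prod' fun i _ ↦ tsub_le_tsub_left (hmono h _) _
  have hmeas : ∀ m, Measurable fun ω ↦ ⨅ n, ∏ i ∈ Finset.range n, (1 - s m (X i ω)) := fun m ↦
    .iInf fun n ↦ Finset.measurable_prod _ fun i _ ↦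
      ((s m).measurable.comp (hX.measurable i)).const_sub 1
  have hval : ∀ m, ∫⁻ ω, ⨅ n, ∏ i ∈ Finset.range n, (1 - s m (X i ω)) ∂P
      = ENNReal.ofReal (Real.exp (-((s m).lintegral Λ).toReal)) := fun m ↦ by
    refine hX.lintegral_iInf_prod_simpleFunc (s m) (fun x ↦ (hsg m x).trans (hg1 x)) ?_
    rw [← SimpleFunc.lintegral_eq_lintegral]
    exact ne_top_of_le_ne_top hfin (lintegral_mono (hsg m))
  have hanti : Antitone fun m ω ↦ ⨅ n, ∏ i ∈ Finset.range n, (1 - s m (X i ω)) :=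
    fun m m' h ω ↦ iInf_mono fun n ↦
      Finset.prod_le_prod' fun i _ ↦ tsub_le_tsub_left (hmono h _) _
  simp only [hswap]
  rw [lintegral_iInf hmeas hanti (by rw [hval]; exact ENNReal.ofReal_ne_top)]
  refine tendsto_nhds_unique (tendsto_atTop_iInf fun m m' h ↦ lintegral_mono (hanti h)) ?_
  simp only [hval]
  have h3 : Tendsto (fun m ↦ (s m).lintegral Λ) atTop (𝓝 (∫⁻ x, g x ∂Λ)) := by
    rw [lintegral_eq_iSup_eapprox_lintegral hg]
    exact tendsto_atTop_iSup fun m m' h ↦ SimpleFunc.lintegral_mono (hmono h) le_rfl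
  exact ENNReal.tendsto_ofReal ((Real.continuous_exp.tendsto _).comp
    ((ENNReal.tendsto_toReal hfin).comp h3).neg)

end PoissonPointProcess

/-! ### Transforms and tails of the fading laws. -/

lemma measurable_gammaPDF (a r : ℝ) : Measurable (gammaPDF a r) :=
  (measurable_gammaPDFReal a r).ennreal_ofReal

/-- Laplace transform of the gamma distribution. -/
lemma lintegral_exp_neg_mul_gammaMeasure {a r s : ℝ} (ha : 0 < a) (hr : 0 < r) (hs : 0 ≤ s) :
    ∫⁻ h, ENNReal.ofReal (Real.exp (-(s * h))) ∂(gammaMeasure a r)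
      = ENNReal.ofReal (r ^ a / (s + r) ^ a) := by
  have hsr : 0 < s + r := by positivity
  rw [gammaMeasure, lintegral_withDensity_eq_lintegral_mul _
    (measurable_gammaPDF a r)
    (by fun_prop)]
  -- Exponential tilting: the tilted density is a multiple of the gamma density of rate `s + r`.
  have h : ∀ x, (gammaPDF a r * fun h ↦ ENNReal.ofReal (Real.exp (-(s * h)))) x
      = ENNReal.ofReal (r ^ a / (s + r) ^ a) * gammaPDF a (s + r) x := by
    intro x
    simp only [Pi.mul_apply, gammaPDF]
    rw [← ENNReal.ofReal_mul (gammaPDFReal_nonneg ha hr x), ← ENNReal.ofReal_mul (by positivity)]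
    congr 1
    unfold gammaPDFReal
    split_ifs
    · have h1 : Real.exp (-((s + r) * x)) = Real.exp (-(r * x)) * Real.exp (-(s * x)) := by
        rw [← Real.exp_add]; ring_nf
      rw [h1]
      have : (s + r) ^ a ≠ 0 := by positivity
      field_simp
    · simp
  simp only [h]
  rw [lintegral_const_mul _ (measurable_gammaPDF a _),
    lintegral_gammaPDF_eq_one ha hsr, mul_one]

lemma ae_nonneg_gammaMeasure (a r : ℝ) : ∀ᵐ h ∂(gammaMeasure a r), 0 ≤ h := by
  rw [gammaMeasure, ae_withDensity_iff
    (measurable_gammaPDF a r)]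
  refine .of_forall fun x hx ↦ ?_
  by_contra h
  exact hx (gammaPDF_of_neg (not_le.1 h))

lemma expMeasure_one_Ioi {x : ℝ} (hx : 0 ≤ x) :
    expMeasure 1 (Set.Ioi x) = ENNReal.ofReal (Real.exp (-x)) := by
  have := isProbabilityMeasure_expMeasure one_pos
  have h := cdf_expMeasure_eq one_pos x
  rw [cdf_eq_real, if_pos hx, one_mul] at h
  rw [← Set.compl_Iic, ← ofReal_measureReal, probReal_compl_eq_one_sub measurableSet_Iic, h,
    sub_sub_cancel]

lemma expMeasure_one_Ici {x : ℝ} (hx : 0 ≤ x) :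
    expMeasure 1 (Set.Ici x) = ENNReal.ofReal (Real.exp (-x)) := by
  rw [← expMeasure_one_Ioi hx]
  refine measure_congr ((withDensity_absolutelyContinuous volume _).ae_eq Ioi_ae_eq_Ici.symm)

/-! ### The LoS probability at small height. -/

lemma qFun_zero : qFun 0 = 1 / 2 := by
  have h0 : Real.sqrt (2 * Real.pi) ≠ 0 := by positivity
  have h := integral_gaussian_Ioi (1 / 2)
  have h1 : ∀ t : ℝ, -(1 / 2) * t ^ 2 = -(t ^ 2 / 2) := fun t ↦ by ring
  simp only [h1] at h
  rw [qFun, integral_const_mul, h]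
  have : Real.pi / (1 / 2) = 2 * Real.pi := by ring
  rw [this]
  field_simp

lemma sqrt_two_pi_mul_half_sub_qFun (y : ℝ) :
    Real.sqrt (2 * Real.pi) * (1 / 2 - qFun y) = ∫ t in (0 : ℝ)..y, Real.exp (-(t ^ 2 / 2)) := by
  have hint : Integrable fun t : ℝ ↦ Real.exp (-(t ^ 2 / 2)) := by
    convert! integrable_exp_neg_mul_sq (b := 1 / 2) (by norm_num) using 3
    ring
  have h0 : Real.sqrt (2 * Real.pi) ≠ 0 := by positivity
  rw [← qFun_zero, qFun, qFun, integral_const_mul, integral_const_mul, ← mul_sub,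
    intervalIntegral.integral_Ioi_sub_Ioi' hint.integrableOn hint.integrableOn]
  field_simp

/-- For `z > 0` the base is one minus the mean of `exp (-t² / 2)` over `[0, z / ζ]`, and that mean
lies between the endpoint value and `1`. -/
lemma losBase_mem (S : Params) {z : ℝ} (hz : 0 ≤ z) :
    losBase S z ∈ Set.Icc 0 (1 - Real.exp (-((z / S.ζ) ^ 2 / 2))) := by
  rcases hz.eq_or_lt with rfl | hz
  · simp [losBase]
  have hζ := S.ζ_pos
  obtain ⟨y, hy⟩ : ∃ y, y = z / S.ζ := ⟨_, rfl⟩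
  have hy0 : 0 < y := by rw [hy]; positivity
  have hI := sqrt_two_pi_mul_half_sub_qFun y
  have hint : ∀ f : ℝ → ℝ, Continuous f → IntervalIntegrable f volume 0 y :=
    fun f hf ↦ hf.intervalIntegrable _ _
  have hup : ∫ t in (0 : ℝ)..y, Real.exp (-(t ^ 2 / 2)) ≤ y := by
    have := intervalIntegral.integral_mono_on hy0.le (hint (fun t ↦ Real.exp (-(t ^ 2 / 2)))
      (by fun_prop)) (hint (fun _ ↦ 1) (by fun_prop))
      fun t _ ↦ Real.exp_le_one_iff.2 (by nlinarith [sq_nonneg t])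
    simpa using this
  have hlo : y * Real.exp (-(y ^ 2 / 2)) ≤ ∫ t in (0 : ℝ)..y, Real.exp (-(t ^ 2 / 2)) := by
    have := intervalIntegral.integral_mono_on hy0.le (hint (fun _ ↦ Real.exp (-(y ^ 2 / 2)))
      (by fun_prop)) (hint (fun t ↦ Real.exp (-(t ^ 2 / 2))) (by fun_prop))
      fun t ht ↦ Real.exp_le_exp.2 (by nlinarith [ht.1, ht.2])
    simpa using this
  have hs : 0 < Real.sqrt (2 * Real.pi) := by positivity
  have habs : |qFun y - 1 / 2| = 1 / 2 - qFun y := by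
    rw [abs_of_nonpos, neg_sub]
    have : 0 ≤ Real.sqrt (2 * Real.pi) * (1 / 2 - qFun y) := by
      rw [hI]; exact le_trans (by positivity) hlo
    linarith [nonneg_of_mul_nonneg_right this hs]
  have hval : losBase S z = 1 - (∫ t in (0 : ℝ)..y, Real.exp (-(t ^ 2 / 2))) / y := by
    rw [losBase, if_neg hz.ne', ← hy, habs, ← hI, hy]
    field_simp
  rw [hval, ← hy]
  constructor
  · rw [sub_nonneg, div_le_one hy0]; exact hup
  · gcongr
    rw [le_div_iff₀ hy0, mul_comm]; exact hlo

lemma tendsto_losBase (S : Params) : Tendsto (losBase S) (𝓝[≥] 0) (𝓝 0) := by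
  refine tendsto_of_tendsto_of_tendsto_of_le_of_le' (g := fun _ ↦ (0 : ℝ))
    (h := fun z ↦ 1 - Real.exp (-((z / S.ζ) ^ 2 / 2))) tendsto_const_nhds ?_ ?_ ?_
  · have : Continuous fun z : ℝ ↦ 1 - Real.exp (-((z / S.ζ) ^ 2 / 2)) := by fun_prop
    exact tendsto_nhdsWithin_of_tendsto_nhds (this.tendsto' _ _ (by simp))
  · filter_upwards [self_mem_nhdsWithin] with z hz using (losBase_mem S hz).1
  · filter_upwards [self_mem_nhdsWithin] with z hz using (losBase_mem S hz).2

lemma pLos_mem (S : Params) {d z : ℝ} (hd : 0 ≤ d) (hz : 0 ≤ z) :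
    pLos S d z ∈ Set.Icc (0 : ℝ) 1 := by
  have h := losBase_mem S hz
  exact ⟨Real.rpow_nonneg h.1 _, Real.rpow_le_one h.1
    (h.2.trans (by linarith [Real.exp_pos (-((z / S.ζ) ^ 2 / 2))])) (by positivity)⟩

/-! ### Coverage probability at a fixed point. -/

/-- The closed form of the probability that the SINR at `x` exceeds the threshold `t`. -/
noncomputable def coverageProb (S : Params) (u : Ground) (z : ℝ) (x : Ground) (t : ℝ) : ℝ :=
  S.mL ^ S.mL / (t * tau S u z x true / rho S x + S.mL) ^ S.mL
      * Real.exp (-(t * S.noise / rho S x)) * pLos S (dist u x) z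
    + rho S x / (rho S x + t * tau S u z x false)
      * Real.exp (-(t * S.noise / rho S x)) * pNlos S (dist u x) z

lemma tau_nonneg (S : Params) (u : Ground) (z : ℝ) (x : Ground) (e : Bool) :
    0 ≤ tau S u z x e :=
  mul_nonneg (Real.rpow_nonneg (Real.sqrt_nonneg _) _) S.Pu_pos.le

lemma rho_pos (S : Params) {x : Ground} (hx : x ≠ 0) : 0 < rho S x :=
  mul_pos (Real.rpow_pos_of_pos (norm_pos_iff.2 hx) _) S.Pt_pos

lemma channelLaw_apply (S : Params) (u : Ground) (z : ℝ) (x : Ground) {A : Set Channel}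
    (hA : MeasurableSet A) :
    channelLaw S u z x A =
      ENNReal.ofReal (pLos S (dist u x) z) *
        ∫⁻ h, expMeasure 1 {k | (k, true, h) ∈ A} ∂(gammaMeasure S.mL S.mL) +
      ENNReal.ofReal (pNlos S (dist u x) z) *
        ∫⁻ h, expMeasure 1 {k | (k, false, h) ∈ A} ∂(expMeasure 1) := by
  have i1 := isProbabilityMeasure_expMeasure one_pos
  have i2 := isProbabilityMeasure_gammaMeasure S.mL_pos S.mL_pos
  have hm := measurable_measure_prodMk_right (μ := expMeasure 1) hA
  rw [channelLaw, Measure.prod_apply_symm hA, lintegral_add_measure, lintegral_smul_measure,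
    lintegral_smul_measure, Measure.dirac_prod, Measure.dirac_prod,
    lintegral_map hm (by fun_prop), lintegral_map hm (by fun_prop)]
  rfl

/-- Given the Jammer's link, the Tx gain must exceed a threshold affine in the Jammer gain `k`;
averaging the exponential tail over `k` is a Laplace transform. The hypothesis on `A` covers strict
and non-strict events alike. -/
lemma channelLaw_apply_of_exp (S : Params) {u : Ground} {z : ℝ} (hz : 0 ≤ z) {x : Ground}
    (hx : x ≠ 0) {t : ℝ} (ht : 0 < t) {A : Set Channel} (hA : MeasurableSet A)
    (h : ∀ e k, 0 ≤ k → expMeasure 1 {j | (j, e, k) ∈ A} =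
      ENNReal.ofReal (Real.exp (-(t * (k * tau S u z x e + S.noise) / rho S x)))) :
    channelLaw S u z x A = ENNReal.ofReal (coverageProb S u z x t) := by
  have hρ := rho_pos S hx
  have key : ∀ (e : Bool) {a : ℝ}, 0 < a →
      ∫⁻ k, expMeasure 1 {j | (j, e, k) ∈ A} ∂(gammaMeasure a a) =
        ENNReal.ofReal (a ^ a / (t * tau S u z x e / rho S x + a) ^ a
          * Real.exp (-(t * S.noise / rho S x))) := by
    intro e a ha
    have hτ := tau_nonneg S u z x e
    have h1 : ∫⁻ k, expMeasure 1 {j | (j, e, k) ∈ A} ∂(gammaMeasure a a) =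
        ∫⁻ k, ENNReal.ofReal (Real.exp (-((t * tau S u z x e / rho S x) * k))) *
          ENNReal.ofReal (Real.exp (-(t * S.noise / rho S x))) ∂(gammaMeasure a a) := by
      refine lintegral_congr_ae ?_
      filter_upwards [ae_nonneg_gammaMeasure a a] with k hk
      rw [h e k hk, ← ENNReal.ofReal_mul (Real.exp_pos _).le, ← Real.exp_add]
      ring_nf
    rw [h1, lintegral_mul_const _ (by fun_prop),
      lintegral_exp_neg_mul_gammaMeasure ha ha (by positivity),
      ← ENNReal.ofReal_mul (by positivity)]
  have hp := pLos_mem S (dist_nonneg (x := u) (y := x)) hz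
  have hp' : 0 ≤ pNlos S (dist u x) z := sub_nonneg.2 hp.2
  have hτ := tau_nonneg S u z x
  have hτ1 := hτ true
  have hτ2 := hτ false
  have hm := S.mL_pos
  -- Rayleigh fading is the gamma case of shape and rate `1`.
  have h2 : (1 : ℝ) ^ (1 : ℝ) / (t * tau S u z x false / rho S x + 1) ^ (1 : ℝ)
      = rho S x / (rho S x + t * tau S u z x false) := by
    rw [Real.rpow_one, Real.rpow_one]
    field_simp
    ring
  have h3 := hp.1
  have hN : ∫⁻ k, expMeasure 1 {j | (j, false, k) ∈ A} ∂(expMeasure 1) = _ := key false one_pos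
  rw [channelLaw_apply S u z x hA, key true S.mL_pos, hN, h2,
    ← ENNReal.ofReal_mul h3, ← ENNReal.ofReal_mul hp', ← ENNReal.ofReal_add (by positivity)
    (by positivity), coverageProb]
  congr 1
  ring

@[fun_prop]
lemma measurable_sinr (S : Params) (u : Ground) (z : ℝ) :
    Measurable fun p : Ground × Channel ↦ sinr S u z p.1 p.2 := by
  have h : Measurable fun p : Ground × Channel ↦ pathLossExp S p.2.2.1 :=
    (Measurable.of_discrete (f := pathLossExp S)).comp (by fun_prop)
  unfold sinr rho tau jamDist
  fun_prop

lemma measurable_sinr_right (S : Params) (u : Ground) (z : ℝ) (x : Ground) :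
    Measurable (sinr S u z x) :=
  (measurable_sinr S u z).comp measurable_prodMk_left

lemma channelLaw_lt_sinr (S : Params) {u : Ground} {z : ℝ} (hz : 0 ≤ z) {x : Ground}
    (hx : x ≠ 0) {t : ℝ} (ht : 0 < t) :
    channelLaw S u z x {c | t < sinr S u z x c} = ENNReal.ofReal (coverageProb S u z x t) := by
  refine channelLaw_apply_of_exp S hz hx ht
    (measurableSet_lt measurable_const (measurable_sinr_right S u z x)) fun e k hk ↦ ?_
  have hρ := rho_pos S hx
  have hτ := tau_nonneg S u z x e
  have hσ := S.noise_pos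
  rw [← expMeasure_one_Ioi (by positivity)]
  congr 1
  ext j
  simp only [sinr, Set.mem_ofPred_eq, Set.mem_Ioi]
  rw [lt_div_iff₀ (by positivity), div_lt_iff₀ hρ]

lemma channelLaw_le_sinr (S : Params) {u : Ground} {z : ℝ} (hz : 0 ≤ z) {x : Ground}
    (hx : x ≠ 0) {t : ℝ} (ht : 0 < t) :
    channelLaw S u z x {c | t ≤ sinr S u z x c} = ENNReal.ofReal (coverageProb S u z x t) := by
  refine channelLaw_apply_of_exp S hz hx ht
    (measurableSet_le measurable_const (measurable_sinr_right S u z x)) fun e k hk ↦ ?_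
  have hρ := rho_pos S hx
  have hτ := tau_nonneg S u z x e
  have hσ := S.noise_pos
  rw [← expMeasure_one_Ici (by positivity)]
  congr 1
  ext j
  simp only [sinr, Set.mem_ofPred_eq, Set.mem_Ici]
  rw [le_div_iff₀ (by positivity), div_le_iff₀ hρ]

lemma isProbabilityMeasure_channelLaw (S : Params) (u : Ground) {z : ℝ} (hz : 0 ≤ z)
    (x : Ground) : IsProbabilityMeasure (channelLaw S u z x) := by
  have i1 := isProbabilityMeasure_expMeasure one_pos
  have i2 := isProbabilityMeasure_gammaMeasure S.mL_pos S.mL_pos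
  have hp := pLos_mem S (dist_nonneg (x := u) (y := x)) hz
  refine ⟨?_⟩
  rw [channelLaw_apply S u z x .univ]
  simp only [Set.mem_univ, Set.ofPred_true, measure_univ, lintegral_const, mul_one]
  rw [pNlos, ← ENNReal.ofReal_add hp.1 (sub_nonneg.2 hp.2)]
  simp

/-- The probability that an eavesdropper at `x` eavesdrops. -/
noncomputable def eavesProb (S : Params) (u : Ground) (z : ℝ) (x : Ground) : ℝ :=
  if x = 0 then 0 else coverageProb S u z x S.γt'

lemma channelLaw_sinr_lt (S : Params) {u : Ground} {z : ℝ} (hz : 0 ≤ z) (x : Ground) :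
    channelLaw S u z x {c | sinr S u z x c < S.γt'} =
      1 - ENNReal.ofReal (eavesProb S u z x) := by
  have := isProbabilityMeasure_channelLaw S u hz x
  by_cases hx : x = 0
  · subst hx
    -- At the origin `0 ^ (-αN)` is `0` by convention, hence the SINR is `0`; this explains the
    -- value of `eavesProb` there.
    have h : {c | sinr S u z 0 c < S.γt'} = Set.univ := by
      ext c
      simp [sinr, rho, S.γt'_pos, S.αN_pos.ne']
    rw [h, measure_univ]
    simp [eavesProb]
  · rw [eavesProb, if_neg hx, ← channelLaw_le_sinr S hz hx S.γt'_pos,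
      ← prob_compl_eq_one_sub
        (measurableSet_le measurable_const (measurable_sinr_right S u z x))]
    congr 1
    ext c
    simp

lemma measurable_eavesProb (S : Params) (u : Ground) (z : ℝ) : Measurable (eavesProb S u z) := by
  refine Measurable.ite (measurableSet_singleton 0) measurable_const ?_
  unfold coverageProb pNlos pLos rho tau jamDist
  fun_prop

lemma mul_noise_div_rho (S : Params) (t : ℝ) {x : Ground} (hx : x ≠ 0) :
    t * S.noise / rho S x = t * S.noise / S.Pt * ‖x‖ ^ S.αN := by
  have h : 0 < ‖x‖ ^ S.αN := Real.rpow_pos_of_pos (norm_pos_iff.2 hx) _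
  have := S.Pt_pos
  rw [rho, Real.rpow_neg (norm_nonneg x)]
  field_simp

lemma coverageProb_nonneg (S : Params) (u : Ground) {z : ℝ} (hz : 0 ≤ z) {x : Ground}
    (hx : x ≠ 0) {t : ℝ} (ht : 0 < t) : 0 ≤ coverageProb S u z x t := by
  have hρ := rho_pos S hx
  have hτ1 := tau_nonneg S u z x true
  have hτ2 := tau_nonneg S u z x false
  have hm := S.mL_pos
  have hp := pLos_mem S (dist_nonneg (x := u) (y := x)) hz
  have h1 := hp.1
  have h2 : 0 ≤ pNlos S (dist u x) z := sub_nonneg.2 hp.2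
  unfold coverageProb
  positivity

/-- Both interference factors are at most `1` and the environment probabilities sum to `1`, so only
the noise term survives. Being uniform in the Jammer position, the bound serves for dominated
convergence. -/
lemma coverageProb_le (S : Params) (u : Ground) {z : ℝ} (hz : 0 ≤ z) {x : Ground}
    (hx : x ≠ 0) {t : ℝ} (ht : 0 < t) :
    coverageProb S u z x t ≤ Real.exp (-(t * S.noise / S.Pt * ‖x‖ ^ S.αN)) := by
  have hρ := rho_pos S hx
  have hτ1 := tau_nonneg S u z x true
  have hτ2 := tau_nonneg S u z x false
  have hm := S.mL_pos
  have hp := pLos_mem S (dist_nonneg (x := u) (y := x)) hz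
  have h1 := hp.1
  have h2 : 0 ≤ pNlos S (dist u x) z := sub_nonneg.2 hp.2
  have h3 : S.mL ^ S.mL / (t * tau S u z x true / rho S x + S.mL) ^ S.mL ≤ 1 := by
    rw [div_le_one (by positivity)]
    exact Real.rpow_le_rpow hm.le (le_add_of_nonneg_left (by positivity)) hm.le
  have h4 : rho S x / (rho S x + t * tau S u z x false) ≤ 1 := by
    rw [div_le_one (by positivity)]
    exact le_add_of_nonneg_right (by positivity)
  rw [← mul_noise_div_rho S t hx, coverageProb]
  calc _ ≤ 1 * Real.exp (-(t * S.noise / rho S x)) * pLos S (dist u x) z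
        + 1 * Real.exp (-(t * S.noise / rho S x)) * pNlos S (dist u x) z := by gcongr
    _ = _ := by rw [pNlos]; ring

/-! ### Limits as the Jammer approaches the Tx. -/

/-- The filter of positions of the Jammer, above the ground, that approach the Tx. -/
abbrev approach : Filter (Ground × ℝ) := 𝓝 0 ×ˢ 𝓝[≥] 0

lemma eventually_approach_nonneg : ∀ᶠ p in approach, 0 ≤ p.2 :=
  tendsto_snd.eventually self_mem_nhdsWithin

lemma tendsto_dist_approach (x : Ground) :
    Tendsto (fun p : Ground × ℝ ↦ dist p.1 x) approach (𝓝 ‖x‖) := by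
  have : Continuous fun v : Ground ↦ dist v x := by fun_prop
  exact (this.tendsto' 0 _ (by simp)).comp tendsto_fst

lemma tendsto_pLos_approach (S : Params) {x : Ground} (hx : x ≠ 0) :
    Tendsto (fun p : Ground × ℝ ↦ pLos S (dist p.1 x) p.2) approach (𝓝 0) := by
  have hpos : 0 < ‖x‖ * Real.sqrt (S.ν * S.μ) :=
    mul_pos (norm_pos_iff.2 hx) (Real.sqrt_pos.2 (mul_pos S.ν_pos S.μ_pos))
  have h := ((tendsto_losBase S).comp (tendsto_snd (f := 𝓝 (0 : Ground)))).rpow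
    -- The base tends to `0`; `rpow` is still continuous there because the limiting exponent is
    -- positive.
    ((tendsto_dist_approach x).mul_const (Real.sqrt (S.ν * S.μ))) (.inr hpos)
  rw [Real.zero_rpow hpos.ne'] at h
  exact h

lemma tendsto_tau_approach (S : Params) {x : Ground} (hx : x ≠ 0) (e : Bool) :
    Tendsto (fun p : Ground × ℝ ↦ tau S p.1 p.2 x e) approach
      (𝓝 (‖x‖ ^ (-pathLossExp S e) * S.Pu)) := by
  have hz : Tendsto (fun p : Ground × ℝ ↦ p.2) approach (𝓝 0) :=
    tendsto_snd.mono_right nhdsWithin_le_nhds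
  have h := (((tendsto_dist_approach x).pow 2).add (hz.pow 2)).sqrt
  rw [zero_pow two_ne_zero, add_zero, Real.sqrt_sq (norm_nonneg x)] at h
  exact (h.rpow_const (.inl (norm_ne_zero_iff.2 hx))).mul_const _

lemma tendsto_coverageProb_approach (S : Params) {x : Ground} (hx : x ≠ 0) {t : ℝ} (ht : 0 < t) :
    Tendsto (fun p : Ground × ℝ ↦ coverageProb S p.1 p.2 x t) approach
      (𝓝 (S.Pt / (t * S.Pu + S.Pt) * Real.exp (-(t * S.noise / S.Pt * ‖x‖ ^ S.αN)))) := by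
  have hρ := rho_pos S hx
  have hPu := S.Pu_pos
  have hPt := S.Pt_pos
  have hm := S.mL_pos
  have hn : 0 < ‖x‖ := norm_pos_iff.2 hx
  have hL := tendsto_pLos_approach S hx
  have hb : 0 < t * (‖x‖ ^ (-pathLossExp S true) * S.Pu) / rho S x + S.mL := by positivity
  have h1 := ((tendsto_const_nhds (x := S.mL ^ S.mL)).div
    (((((tendsto_tau_approach S hx true).const_mul t).div_const (rho S x)).add_const
      S.mL).rpow_const (p := S.mL) (.inl hb.ne')) (by positivity)).mul_const
      (Real.exp (-(t * S.noise / rho S x))) |>.mul hL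
  have hc : 0 < rho S x + t * (‖x‖ ^ (-pathLossExp S false) * S.Pu) := by positivity
  have h2 := ((tendsto_const_nhds (x := rho S x)).div
    (((tendsto_tau_approach S hx false).const_mul t).const_add (rho S x)) hc.ne').mul_const
      (Real.exp (-(t * S.noise / rho S x))) |>.mul (hL.const_sub 1)
  -- Signal and NLoS interference share the factor `‖x‖ ^ (-αN)`, which cancels.
  have h3 : rho S x / (rho S x + t * (‖x‖ ^ (-pathLossExp S false) * S.Pu))
      = S.Pt / (t * S.Pu + S.Pt) := by
    have : 0 < ‖x‖ ^ (-S.αN) := Real.rpow_pos_of_pos hn _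
    simp only [rho, pathLossExp, Bool.false_eq_true, if_false]
    field_simp
    ring
  have h := h1.add h2
  rw [h3, mul_noise_div_rho S t hx, mul_zero, zero_add, sub_zero, mul_one,
    ← mul_noise_div_rho S t hx] at h
  rw [← mul_noise_div_rho S t hx]
  exact h

/-! ### The limiting integral over the plane. -/

lemma integrable_exp_neg_mul_norm_rpow {p c : ℝ} (hp : 0 < p) (hc : 0 < c) :
    Integrable fun x : Ground ↦ Real.exp (-(c * ‖x‖ ^ p)) := by
  rw [integrable_fun_norm_addHaar volume (f := fun r ↦ Real.exp (-(c * r ^ p)))]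
  have := integrableOn_rpow_mul_exp_neg_mul_rpow (s := 1) (by norm_num) hp hc
  simpa using this

lemma integral_exp_neg_mul_norm_rpow {p c : ℝ} (hp : 0 < p) (hc : 0 < c) :
    ∫ x : Ground, Real.exp (-(c * ‖x‖ ^ p))
      = 2 * Real.pi * Real.Gamma (2 / p) / (p * c ^ (2 / p)) := by
  rw [integral_fun_norm_addHaar volume fun r ↦ Real.exp (-(c * r ^ p))]
  have h := integral_rpow_mul_exp_neg_mul_rpow (q := 1) hp (by norm_num) hc
  have h1 : (volume : Measure Ground).real (Metric.ball 0 1) = Real.pi := by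
    simp [Measure.real, Real.pi_nonneg]
  have h2 : ∫ y in Set.Ioi (0 : ℝ), y ^ (Module.finrank ℝ Ground - 1) • Real.exp (-(c * y ^ p))
      = c ^ (-(1 + 1) / p) * (1 / p) * Real.Gamma ((1 + 1) / p) := by
    rw [← h]
    simp
  rw [h1, h2, one_add_one_eq_two, neg_div, Real.rpow_neg hc.le]
  have : 0 < c ^ (2 / p) := by positivity
  simp only [finrank_euclideanSpace, Fintype.card_fin, smul_eq_mul, nsmul_eq_mul, Nat.cast_ofNat]
  field_simp

lemma integral_eavesProb_approach_limit (S : Params) :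
    Real.exp (-(S.lamE * ∫ x : Ground, S.Pt / (S.γt' * S.Pu + S.Pt) *
      Real.exp (-(S.γt' * S.noise / S.Pt * ‖x‖ ^ S.αN)))) = secrecyFactor S := by
  have h1 := S.γt'_pos
  have h2 := S.noise_pos
  have h3 := S.Pt_pos
  have h4 := S.Pu_pos
  have h5 := S.αN_pos
  have hc : 0 < S.γt' * S.noise / S.Pt := by positivity
  have hc' : 0 < (S.γt' * S.noise / S.Pt) ^ (2 / S.αN) := by positivity
  rw [integral_const_mul, integral_exp_neg_mul_norm_rpow h5 hc, secrecyFactor]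
  generalize (S.γt' * S.noise / S.Pt) ^ (2 / S.αN) = y at *
  congr 1
  field_simp

lemma eavesProb_nonneg (S : Params) (u : Ground) {z : ℝ} (hz : 0 ≤ z) (x : Ground) :
    0 ≤ eavesProb S u z x := by
  rw [eavesProb]
  split_ifs with hx
  · exact le_rfl
  · exact coverageProb_nonneg S u hz hx S.γt'_pos

lemma eavesProb_le (S : Params) (u : Ground) {z : ℝ} (hz : 0 ≤ z) (x : Ground) :
    eavesProb S u z x ≤ Real.exp (-(S.γt' * S.noise / S.Pt * ‖x‖ ^ S.αN)) := by
  rw [eavesProb]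
  split_ifs with hx
  · positivity
  · exact coverageProb_le S u hz hx S.γt'_pos

lemma noise_coeff_pos (S : Params) : 0 < S.γt' * S.noise / S.Pt :=
  div_pos (mul_pos S.γt'_pos S.noise_pos) S.Pt_pos

lemma integrable_eavesProb (S : Params) (u : Ground) {z : ℝ} (hz : 0 ≤ z) :
    Integrable (eavesProb S u z) := by
  refine (integrable_exp_neg_mul_norm_rpow S.αN_pos (noise_coeff_pos S)).mono'
    (measurable_eavesProb S u z).aestronglyMeasurable (.of_forall fun x ↦ ?_)
  rw [Real.norm_of_nonneg (eavesProb_nonneg S u hz x)]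
  exact eavesProb_le S u hz x

lemma tendsto_exp_neg_integral_eavesProb (S : Params) :
    Tendsto (fun p : Ground × ℝ ↦ Real.exp (-(S.lamE * ∫ x, eavesProb S p.1 p.2 x))) approach
      (𝓝 (secrecyFactor S)) := by
  rw [← integral_eavesProb_approach_limit]
  refine (Real.continuous_exp.tendsto _).comp (Tendsto.neg (Tendsto.const_mul _ ?_))
  refine tendsto_integral_filter_of_dominated_convergence _
    (.of_forall fun p ↦ (measurable_eavesProb S p.1 p.2).aestronglyMeasurable) ?_
    (integrable_exp_neg_mul_norm_rpow S.αN_pos (noise_coeff_pos S)) ?_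
  · filter_upwards [eventually_approach_nonneg] with p hp
    refine .of_forall fun x ↦ ?_
    rw [Real.norm_of_nonneg (eavesProb_nonneg S _ hp x)]
    exact eavesProb_le S _ hp x
  -- The LoS probability need not vanish at the origin, but that point is null.
  · have h0 : ∀ᵐ x : Ground, x ≠ 0 := by simp [ae_iff]
    filter_upwards [h0] with x hx
    simp only [eavesProb, if_neg hx]
    exact tendsto_coverageProb_approach S hx S.γt'_pos

/-! ### Exact secrecy probability for a fixed Jammer. -/

namespace Network

variable {S : Params} {u : Ground} {z : ℝ} {Ω : Type*} [MeasurableSpace Ω] {P : Measure Ω}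

lemma measure_rx_success (N : Network S u z P) (hz : 0 ≤ z) :
    P {ω | S.γt < sinr S u z S.rx (N.rxChannel ω)} = ENNReal.ofReal (successProb S u z) := by
  have h := channelLaw_lt_sinr S (u := u) hz S.rx_ne S.γt_pos
  rw [← N.rxChannel_law, Measure.map_apply N.measurable_rxChannel
    (measurableSet_lt measurable_const (measurable_sinr_right S u z S.rx))] at h
  exact h

lemma measure_no_eavesdropping [IsProbabilityMeasure P] (N : Network S u z P) (hz : 0 ≤ z) :
    P {ω | ∀ i, sinr S u z (N.eve i ω) (N.eveChannel i ω) < S.γt'} =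
      ENNReal.ofReal (Real.exp (-(S.lamE * ∫ x, eavesProb S u z x))) := by
  have hA : MeasurableSet {p : Ground × Channel | sinr S u z p.1 p.2 < S.γt'} :=
    measurableSet_lt (measurable_sinr S u z) measurable_const
  have hmeas : ∀ i, Measurable fun ω ↦ (N.eve i ω, N.eveChannel i ω) := fun i ↦
    (N.eve_poisson.measurable i).prodMk (N.measurable_eveChannel i)
  let g : Ground → ℝ≥0∞ := fun x ↦ ENNReal.ofReal (eavesProb S u z x)
  have hg : Measurable g := (measurable_eavesProb S u z).ennreal_ofReal
  have hg1 : ∀ x, g x ≤ 1 := fun x ↦ by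
    refine ENNReal.ofReal_le_one.2 ((eavesProb_le S u hz x).trans (Real.exp_le_one_iff.2 ?_))
    have := noise_coeff_pos S
    simp only [Left.neg_nonpos_iff]
    positivity
  have hint : ∫⁻ x, g x ∂(ENNReal.ofReal S.lamE • (volume : Measure Ground))
      = ENNReal.ofReal (S.lamE * ∫ x, eavesProb S u z x) := by
    rw [lintegral_smul_measure, ENNReal.ofReal_mul S.lamE_pos.le, smul_eq_mul,
      ofReal_integral_eq_lintegral_ofReal (integrable_eavesProb S u hz)
        (.of_forall fun x ↦ eavesProb_nonneg S u hz x)]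
  have hpgfl := N.eve_poisson.lintegral_iInf_prod hg hg1 (by rw [hint]; exact ENNReal.ofReal_ne_top)
  rw [hint, ENNReal.toReal_ofReal (mul_nonneg S.lamE_pos.le
    (integral_nonneg fun x ↦ eavesProb_nonneg S u hz x))] at hpgfl
  rw [← hpgfl]
  -- The conditional law covers finitely many eavesdroppers, so the event is written as a decreasing
  -- intersection; continuity from above matches the infimum of partial products.
  have hset : {ω | ∀ i, sinr S u z (N.eve i ω) (N.eveChannel i ω) < S.γt'} =
      ⋂ n, {ω | ∀ i ∈ Finset.range n,
        (N.eve i ω, N.eveChannel i ω) ∈ {p : Ground × Channel | sinr S u z p.1 p.2 < S.γt'}} := by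
    ext ω
    simp only [Set.mem_ofPred_eq, Set.mem_iInter, Finset.mem_range]
    exact ⟨fun h _ i _ ↦ h i, fun h i ↦ h (i + 1) i i.lt_succ_self⟩
  have hanti : Antitone fun n ↦ {ω | ∀ i ∈ Finset.range n,
        (N.eve i ω, N.eveChannel i ω) ∈ {p : Ground × Channel | sinr S u z p.1 p.2 < S.γt'}} :=
    fun m n hmn ω h i hi ↦ h i (Finset.range_mono hmn hi)
  have hms : ∀ n, MeasurableSet {ω | ∀ i ∈ Finset.range n,
      (N.eve i ω, N.eveChannel i ω) ∈ {p : Ground × Channel | sinr S u z p.1 p.2 < S.γt'}} := by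
    intro n
    have : {ω | ∀ i ∈ Finset.range n,
        (N.eve i ω, N.eveChannel i ω) ∈ {p : Ground × Channel | sinr S u z p.1 p.2 < S.γt'}} =
        ⋂ i ∈ Finset.range n, (fun ω ↦ (N.eve i ω, N.eveChannel i ω)) ⁻¹'
          {p : Ground × Channel | sinr S u z p.1 p.2 < S.γt'} := by
      ext ω; simp
    rw [this]
    exact Finset.measurableSet_biInter _ fun i _ ↦ hmeas i hA
  rw [hset, hanti.measure_iInter (fun n ↦ (hms n).nullMeasurableSet) ⟨0, measure_ne_top _ _⟩,
    lintegral_iInf]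
  · congr with n
    rw [N.eveChannel_law (Finset.range n) (fun _ ↦ {p | sinr S u z p.1 p.2 < S.γt'}) fun _ ↦ hA]
    refine lintegral_congr fun ω ↦ Finset.prod_congr rfl fun i _ ↦ ?_
    exact channelLaw_sinr_lt S hz (N.eve i ω)
  · exact fun n ↦ Finset.measurable_prod _ fun i _ ↦
      (hg.comp (N.eve_poisson.measurable i)).const_sub 1
  · exact antitone_nat_of_succ_le fun n ω ↦ by
      simp only [Finset.prod_range_succ]; exact mul_le_of_le_one_right' tsub_le_self
  · simp

lemma secrecyProb_eq [IsProbabilityMeasure P] (N : Network S u z P) (hz : 0 ≤ z) :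
    N.secrecyProb =
      successProb S u z * Real.exp (-(S.lamE * ∫ x, eavesProb S u z x)) := by
  have hR : MeasurableSet {c | S.γt < sinr S u z S.rx c} :=
    measurableSet_lt measurable_const (measurable_sinr_right S u z S.rx)
  have hE : MeasurableSet {y : ℕ → Ground × Channel | ∀ i, sinr S u z (y i).1 (y i).2 < S.γt'} := by
    rw [Set.ofPred_forall]
    exact .iInter fun i ↦ measurableSet_lt
      ((measurable_sinr S u z).comp (measurable_pi_apply i)) measurable_const
  have h := N.indep.measure_inter_preimage_eq_mul _ _ hR hE
  have h0 : 0 ≤ successProb S u z := coverageProb_nonneg S u hz S.rx_ne S.γt_pos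
  have h' : P {ω | S.γt < sinr S u z S.rx (N.rxChannel ω) ∧
      ∀ i, sinr S u z (N.eve i ω) (N.eveChannel i ω) < S.γt'} =
      ENNReal.ofReal (successProb S u z) *
        ENNReal.ofReal (Real.exp (-(S.lamE * ∫ x, eavesProb S u z x))) := by
    rw [← N.measure_rx_success hz, ← N.measure_no_eavesdropping hz]
    exact h
  rw [secrecyProb, Measure.real, h', ENNReal.toReal_mul, ENNReal.toReal_ofReal h0,
    ENNReal.toReal_ofReal (Real.exp_pos _).le]

end Network

end UAVJammer

/-- The Jammer is at height `z i ≥ 0` above the ground point `u i`, at horizontal distance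
`d_tu = ‖u i‖` from the Tx. Along any filter `l` for which `d_tu` and the height tend to `0`, the
secrecy transmission probability is asymptotic to `p_s` times the explicit exponential factor,
both in ratio and in difference. -/
theorem corollary2 (S : UAVJammer.Params) {ι : Type*} (l : Filter ι)
    (u : ι → UAVJammer.Ground) (z : ι → ℝ)
    (hz_nonneg : ∀ i, 0 ≤ z i)
    (hu : Tendsto (fun i => ‖u i‖) l (𝓝 0)) (hz : Tendsto z l (𝓝 0))
    (Ω : ι → Type*) [∀ i, MeasurableSpace (Ω i)]
    (P : ∀ i, Measure (Ω i)) [∀ i, IsProbabilityMeasure (P i)]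
    (N : ∀ i, UAVJammer.Network S (u i) (z i) (P i)) :
    Tendsto (fun i => (N i).secrecyProb /
        (UAVJammer.successProb S (u i) (z i) * UAVJammer.secrecyFactor S)) l (𝓝 1) ∧
      Tendsto (fun i => (N i).secrecyProb -
        UAVJammer.successProb S (u i) (z i) * UAVJammer.secrecyFactor S) l (𝓝 0) := by

  have hap : Tendsto (fun i ↦ (u i, z i)) l UAVJammer.approach :=
    (tendsto_zero_iff_norm_tendsto_zero.2 hu).prodMk
      (tendsto_nhdsWithin_iff.2 ⟨hz, .of_forall hz_nonneg⟩)
  -- `successProb` is by definition `coverageProb` at the Rx. Its limit is positive, so it may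
  -- eventually be cancelled in the ratio, and finite, so the difference tends to `0`.
  have hs := (UAVJammer.tendsto_coverageProb_approach S S.rx_ne S.γt_pos).comp hap
  have he := (UAVJammer.tendsto_exp_neg_integral_eavesProb S).comp hap
  have hF : 0 < UAVJammer.secrecyFactor S := Real.exp_pos _
  have hpos : 0 < S.Pt / (S.γt * S.Pu + S.Pt) *
      Real.exp (-(S.γt * S.noise / S.Pt * ‖S.rx‖ ^ S.αN)) :=
    mul_pos (div_pos S.Pt_pos (add_pos (mul_pos S.γt_pos S.Pu_pos) S.Pt_pos)) (Real.exp_pos _)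
  constructor
  · have h := he.div_const (UAVJammer.secrecyFactor S)
    rw [div_self hF.ne'] at h
    refine h.congr' ?_
    filter_upwards [hs.eventually_const_lt hpos] with i hi
    rw [(N i).secrecyProb_eq (hz_nonneg i)]
    exact (mul_div_mul_left _ _ (ne_of_gt hi)).symm
  · have h := hs.mul (he.sub_const (UAVJammer.secrecyFactor S))
    rw [sub_self, mul_zero] at h
    refine h.congr fun i ↦ ?_
    rw [(N i).secrecyProb_eq (hz_nonneg i)]
    exact mul_sub _ _ _
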